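/- Let $L:\mathbb{R}^m\times\mathbb{R}^n\to\mathbb{R}$ be convex-concave, i.e. $L(x,u)$ is convex in $x$ for each fixed $u$ and concave in $u$ for each fixed $x$; $L$ need not be differentiable. Assume $L$ has a saddle point, i.e. a point $(x_\star,u_\star)$ with $L(x_\star,u)\le L(x_\star,u_\star)\le L(x,u_\star)$ for all $x,u$. Write $z=(x,u)\in\mathbb{R}^{m+n}$ and $G(z)=\partial_xL(x,u)\times\partial_u(-L)(x,u)$, where $\partial$ is the convex subdifferential. Let $g(z;\omega)$ be a stochastic subgradient oracle, i.e. $\mathbb{E}_\omega\, g(z;\omega)\in G(z)$ for all $z$, and assume there are $R_1,R_2\ge 0$ such that, for independent $\omega_1,\omega_2$ with the law of $\omega$, \[ \mathbb{E}_{\omega_1,\omega_2}\|g(z_1;\omega_1)-g(z_2;\omega_2)\|^2\le R_1^2\|z_1-z_2\|^2+R_2^2\qquad\text{for all } z_1,z_2\in\mathbb{R}^{m+n}. \] Let $p\in(1/2,1)$, $\varepsilon\in(0,1/2)$ with $1-p-\varepsilon>0$, and $\gamma>0$. Let $z_0\in\mathbb{R}^{m+n}$, let $\omega_0,\omega_1,\dots$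 be i.i.d. copies of $\omega$, and define the anchored simultaneous stochastic subgradient descent iterates by \[ z_{k+1}=z_k-\frac{1-p}{(k+1)^p}\,g(z_k;\omega_k)+\frac{(1-p)\gamma}{(k+1)^{1-\varepsilon}}(z_0-z_k),\qquad k=0,1,\dots \] Then $z_k\to z_\star$ in $L^2$, i.e. every $z_k$ is square-integrable and $\mathbb{E}\|z_k-z_\star\|^2\to0$, where $z_\star$ is a saddle point of $L$, namely the projection (unique nearest point) of $z_0$ onto the set of saddle points of $L$. -/

import Mathlib

open MeasureTheory ProbabilityTheory Filter Topology

noncomputable section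

/-- The Euclidean space `ℝ^m × ℝ^n = ℝ^(m+n)` of pairs `z = (x, u)`, with the Euclidean
(ℓ²) norm `‖(x, u)‖² = ‖x‖² + ‖u‖²`. -/
abbrev PairSpace (m n : ℕ) : Type :=
  WithLp 2 (EuclideanSpace ℝ (Fin m) × EuclideanSpace ℝ (Fin n))

/-- `L (x, u)` is convex in `x` for every fixed `u` and concave in `u` for every fixed `x`. -/
def IsConvexConcave {m n : ℕ}
    (L : EuclideanSpace ℝ (Fin m) → EuclideanSpace ℝ (Fin n) → ℝ) : Prop :=
  (∀ u, ConvexOn ℝ Set.univ (fun x => L x u)) ∧ (∀ x, ConcaveOn ℝ Set.univ (fun u => L x u))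

/-- `z = (x⋆, u⋆)` is a saddle point: `L (x⋆, u) ≤ L (x⋆, u⋆) ≤ L (x, u⋆)` for all `x`, `u`. -/
def IsSaddlePoint {m n : ℕ} (L : EuclideanSpace ℝ (Fin m) → EuclideanSpace ℝ (Fin n) → ℝ)
    (z : PairSpace m n) : Prop :=
  ∀ x u, L z.fst u ≤ L z.fst z.snd ∧ L z.fst z.snd ≤ L x z.snd

/-- The convex-analysis subdifferential of `f` at `x`: all `v` with
`f x + ⟨v, y - x⟩ ≤ f y` for every `y`. -/
def subdifferential {E : Type*} [NormedAddCommGroup E] [InnerProductSpace ℝ E]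
    (f : E → ℝ) (x : E) : Set E :=
  {v | ∀ y, f x + inner ℝ v (y - x) ≤ f y}

/-- The saddle subdifferential operator `G (x, u) = ∂ₓ L (x, u) × ∂ᵤ (-L) (x, u)`. -/
def saddleOperator {m n : ℕ} (L : EuclideanSpace ℝ (Fin m) → EuclideanSpace ℝ (Fin n) → ℝ)
    (z : PairSpace m n) : Set (PairSpace m n) :=
  {v | v.fst ∈ subdifferential (fun x => L x z.snd) z.fst ∧
       v.snd ∈ subdifferential (fun u => -L z.fst u) z.snd}

/-- `g` is a stochastic subgradient oracle for `L`, the noise having law `ν`: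
`𝔼 g(z; ω) ∈ G z` for every `z` (with `g` jointly measurable, and the expectation existing). -/
structure IsStochasticSubgradientOracle {m n : ℕ} {Ξ : Type*} [MeasurableSpace Ξ]
    (L : EuclideanSpace ℝ (Fin m) → EuclideanSpace ℝ (Fin n) → ℝ)
    (ν : Measure Ξ) (g : PairSpace m n → Ξ → PairSpace m n) : Prop where
  measurable : Measurable (Function.uncurry g)
  integrable : ∀ z, Integrable (g z) ν
  expectation_mem : ∀ z, ∫ ξ, g z ξ ∂ν ∈ saddleOperator L z

/-- The second-moment condition: for independent `ω₁`, `ω₂` with law `ν`,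
`𝔼 ‖g(z₁; ω₁) - g(z₂; ω₂)‖² ≤ R₁² ‖z₁ - z₂‖² + R₂²` for all `z₁`, `z₂`. -/
def SecondMomentBound {m n : ℕ} {Ξ : Type*} [MeasurableSpace Ξ]
    (ν : Measure Ξ) (g : PairSpace m n → Ξ → PairSpace m n) (R₁ R₂ : ℝ) : Prop :=
  ∀ z₁ z₂, Integrable (fun ξ : Ξ × Ξ => ‖g z₁ ξ.1 - g z₂ ξ.2‖ ^ 2) (ν.prod ν) ∧
    ∫ ξ : Ξ × Ξ, ‖g z₁ ξ.1 - g z₂ ξ.2‖ ^ 2 ∂(ν.prod ν) ≤ R₁ ^ 2 * ‖z₁ - z₂‖ ^ 2 + R₂ ^ 2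

/-- The anchored simultaneous stochastic subgradient iterates started at `z₀` and driven by the
noise sequence `ξ`:
`z_{k+1} = z_k - (1-p)/(k+1)^p g(z_k; ξ_k) + (1-p)γ/(k+1)^(1-ε) (z₀ - z_k)`. -/
def anchoredSSSGD {m n : ℕ} {Ξ : Type*} (g : PairSpace m n → Ξ → PairSpace m n)
    (p ε γ : ℝ) (z₀ : PairSpace m n) (ξ : ℕ → Ξ) : ℕ → PairSpace m n
  | 0 => z₀
  | k + 1 =>
    anchoredSSSGD g p ε γ z₀ ξ k
      - ((1 - p) / ((k : ℝ) + 1) ^ p) • g (anchoredSSSGD g p ε γ z₀ ξ k) (ξ k)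
      + ((1 - p) * γ / ((k : ℝ) + 1) ^ (1 - ε)) • (z₀ - anchoredSSSGD g p ε γ z₀ ξ k)

/-- `z` is the projection of `z₀` onto `S`: the unique point of `S` closest to `z₀`. -/
def IsProjectionOnto {E : Type*} [NormedAddCommGroup E] (S : Set E) (z₀ z : E) : Prop :=
  z ∈ S ∧ ∀ w ∈ S, w ≠ z → ‖z - z₀‖ < ‖w - z₀‖

end

/-! The iterates track a Tikhonov path. Put `α k = (1-p)/(k+1)^p`, `β k = (1-p)γ/(k+1)^(1-ε)` and
`lam k = γ (k+1)^(-(1-p-ε))`, so that `β k = α k * lam k`. The anchored step is then a stochastic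
forward step of size `α k` for the strongly monotone operator `G + lam k • (· - z₀)`, whose zero `y
k` is the saddle point of the regularized function.

Monotonicity of `G` contracts the mean-square distance to `y k` by `1 - 2 * β k`, up to noise of
order `α k ^ 2` times one plus that squared distance (`integral_sq_norm_anchored_step_le`). The path
drifts by `O(1/(k+1))` (`IsTikhonovPoint.norm_sub_le_of_param`). Since `∑ β` diverges while `α ^ 2 /
β` and drift over `β` vanish, the tracking error tends to zero
(`tendsto_zero_of_anchored_recursion`).

As `lam k → 0`, `y k` converges to the projection of the anchor onto the saddle set
(`exists_isProjectionOnto_tendsto`). -/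

/-! ### Convex functions: optimality and localization -/

section ConvexAnalysis

variable {E : Type*} [NormedAddCommGroup E] [InnerProductSpace ℝ E]

/-- First-order optimality for a convex function plus a quadratic centred at `c`. -/
theorem neg_smul_mem_subdifferential_of_forall_le {f : E → ℝ} (hf : ConvexOn ℝ Set.univ f)
    {lam : ℝ} {c y : E}
    (h : ∀ x, f y + lam / 2 * ‖y - c‖ ^ 2 ≤ f x + lam / 2 * ‖x - c‖ ^ 2) :
    -(lam • (y - c)) ∈ subdifferential f y := by
  intro x
  -- Compare `y` with the point `(1 - t) • y + t • x` of the segment, use convexity and divide by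
  -- `t`; the quadratic remainder vanishes as `t ↓ 0`.
  have key : ∀ t ∈ Set.Ioc (0 : ℝ) 1,
      0 ≤ f x - f y + lam * inner ℝ (y - c) (x - y) + t * (lam / 2 * ‖x - y‖ ^ 2) := by
    intro t ht
    have h1 := h ((1 - t) • y + t • x)
    have h2 := hf.2 (Set.mem_univ y) (Set.mem_univ x) (by linarith [ht.2] : 0 ≤ 1 - t) ht.1.le
      (by ring)
    have h3 : (1 - t) • y + t • x - c = (y - c) + t • (x - y) := by module
    have h4 : ‖(1 - t) • y + t • x - c‖ ^ 2
        = ‖y - c‖ ^ 2 + 2 * (t * inner ℝ (y - c) (x - y)) + t ^ 2 * ‖x - y‖ ^ 2 := by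
      rw [h3, norm_add_sq_real, inner_smul_right, norm_smul, mul_pow, Real.norm_eq_abs, sq_abs]
    rw [h4] at h1
    simp only [smul_eq_mul] at h2
    have h5 : 0 ≤ t * (f x - f y + lam * inner ℝ (y - c) (x - y)
        + t * (lam / 2 * ‖x - y‖ ^ 2)) := by nlinarith
    exact nonneg_of_mul_nonneg_right h5 ht.1
  have hlim : Tendsto (fun t : ℝ => f x - f y + lam * inner ℝ (y - c) (x - y)
      + t * (lam / 2 * ‖x - y‖ ^ 2)) (𝓝[>] 0)
      (𝓝 (f x - f y + lam * inner ℝ (y - c) (x - y) + 0 * (lam / 2 * ‖x - y‖ ^ 2))) :=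
    (Continuous.tendsto (by fun_prop) 0).mono_left nhdsWithin_le_nhds
  have h0 := ge_of_tendsto hlim
    (Filter.eventually_of_mem (Ioc_mem_nhdsGT one_pos) key)
  rw [inner_neg_left, inner_smul_left]
  simp only [conj_trivial]
  linarith

/-- A minimum over a closed ball, attained in the interior, of a convex function is global. -/
theorem ConvexOn.le_of_forall_mem_closedBall_le {f : E → ℝ} (hf : ConvexOn ℝ Set.univ f)
    {c y : E} {r : ℝ} (hy : y ∈ Metric.ball c r)
    (h : ∀ x ∈ Metric.closedBall c r, f y ≤ f x) (x : E) : f y ≤ f x := by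
  refine IsMinOn.of_isLocalMinOn_of_convexOn (Set.mem_univ y) ?_ hf (Set.mem_univ x)
  have : IsLocalMin f y := by
    filter_upwards [Metric.isOpen_ball.mem_nhds hy] with w hw
    exact h w (Metric.ball_subset_closedBall hw)
  exact this.on _

theorem convexOn_sq_norm_sub (c : E) : ConvexOn ℝ Set.univ (fun x : E => ‖x - c‖ ^ 2) := by
  have h := (convexOn_univ_norm (E := E)).translate_left (-c)
  have h2 : ConvexOn ℝ Set.univ (fun x : E => ‖x - c‖) := by
    simpa [Function.comp_def, sub_eq_add_neg] using h
  exact h2.pow (fun _ _ => norm_nonneg _) 2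

end ConvexAnalysis

/-! ### Monotonicity of the saddle operator and the Tikhonov path -/

section Saddle

variable {m n : ℕ} {L : EuclideanSpace ℝ (Fin m) → EuclideanSpace ℝ (Fin n) → ℝ}

/-- In the sum of the four subgradient inequalities between `z` and `w`, the values of `L` at the
four corner points cancel. -/
theorem saddleOperator_monotone {z w v v' : PairSpace m n} (hv : v ∈ saddleOperator L z)
    (hv' : v' ∈ saddleOperator L w) : 0 ≤ inner ℝ (v - v') (z - w) := by
  obtain ⟨h1, h2⟩ := hv
  obtain ⟨h3, h4⟩ := hv'
  have a1 := h1 w.fst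
  have a2 := h2 w.snd
  have a3 := h3 z.fst
  have a4 := h4 z.snd
  have e : inner ℝ (v - v') (z - w)
      = -(inner ℝ v.fst (w.fst - z.fst) + inner ℝ v.snd (w.snd - z.snd)
        + inner ℝ v'.fst (z.fst - w.fst) + inner ℝ v'.snd (z.snd - w.snd)) := by
    rw [WithLp.prod_inner_apply]
    change inner ℝ (v.fst - v'.fst) (z.fst - w.fst) + inner ℝ (v.snd - v'.snd) (z.snd - w.snd) = _
    simp only [inner_sub_left, inner_sub_right]
    ring
  rw [e]
  simp only at a1 a2 a3 a4
  linarith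

/-- `y` is a saddle point of the Tikhonov-regularized function
`L (x, u) + lam / 2 * ‖x - x₀‖² - lam / 2 * ‖u - u₀‖²`, where `z₀ = (x₀, u₀)`. -/
def IsTikhonovPoint (L : EuclideanSpace ℝ (Fin m) → EuclideanSpace ℝ (Fin n) → ℝ)
    (z₀ : PairSpace m n) (lam : ℝ) (y : PairSpace m n) : Prop :=
  ∀ x u, L y.fst u + lam / 2 * (‖y.fst - z₀.fst‖ ^ 2 - ‖u - z₀.snd‖ ^ 2)
    ≤ L x y.snd + lam / 2 * (‖x - z₀.fst‖ ^ 2 - ‖y.snd - z₀.snd‖ ^ 2)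

theorem isTikhonovPoint_zero_iff {z₀ y : PairSpace m n} :
    IsTikhonovPoint L z₀ 0 y ↔ IsSaddlePoint L y := by
  simp only [IsTikhonovPoint, IsSaddlePoint, zero_div, zero_mul, add_zero]
  exact ⟨fun h x u => ⟨h _ u, h x _⟩, fun h x u => (h x u).1.trans (h x u).2⟩

theorem IsTikhonovPoint.mem_saddleOperator (hL : IsConvexConcave L) {z₀ y : PairSpace m n}
    {lam : ℝ} (h : IsTikhonovPoint L z₀ lam y) : -(lam • (y - z₀)) ∈ saddleOperator L y := by
  constructor
  · change -(lam • (y.fst - z₀.fst)) ∈ _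
    refine neg_smul_mem_subdifferential_of_forall_le (hL.1 _) fun x => ?_
    have := h x y.snd
    linarith
  · change -(lam • (y.snd - z₀.snd)) ∈ _
    refine neg_smul_mem_subdifferential_of_forall_le (hL.2 _).neg fun u => ?_
    have := h y.fst u
    simp only [Pi.neg_apply]
    linarith

theorem IsSaddlePoint.zero_mem_saddleOperator (hL : IsConvexConcave L) {w : PairSpace m n}
    (h : IsSaddlePoint L w) : 0 ∈ saddleOperator L w := by
  simpa using (isTikhonovPoint_zero_iff (z₀ := 0).2 h).mem_saddleOperator hL

/-- Monotonicity between `-(lam • (y - z₀))` at `y` and `0` at `w`, divided by `lam`. The result no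
longer contains `lam`, so it survives the limit `lam → 0`, where it is the variational inequality of
the projection. -/
theorem IsTikhonovPoint.sq_norm_sub_le_inner (hL : IsConvexConcave L) {z₀ y w : PairSpace m n}
    {lam : ℝ} (hlam : 0 < lam) (hy : IsTikhonovPoint L z₀ lam y) (hw : IsSaddlePoint L w) :
    ‖y - z₀‖ ^ 2 ≤ inner ℝ (y - z₀) (w - z₀) := by
  have h := saddleOperator_monotone (hy.mem_saddleOperator hL) (hw.zero_mem_saddleOperator hL)
  have e : y - w = (y - z₀) - (w - z₀) := by abel
  rw [sub_zero, inner_neg_left, inner_smul_left, e, inner_sub_right (y - z₀),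
    real_inner_self_eq_norm_sq] at h
  simp only [conj_trivial] at h
  nlinarith

theorem IsTikhonovPoint.norm_sub_le (hL : IsConvexConcave L) {z₀ y w : PairSpace m n}
    {lam : ℝ} (hlam : 0 < lam) (hy : IsTikhonovPoint L z₀ lam y) (hw : IsSaddlePoint L w) :
    ‖y - z₀‖ ≤ ‖w - z₀‖ := by
  have h := (hy.sq_norm_sub_le_inner hL hlam hw).trans (real_inner_le_norm _ _)
  by_contra! hlt
  nlinarith [norm_nonneg (y - z₀), norm_nonneg (w - z₀)]

/-- Lipschitz dependence of the regularized saddle point on the regularization parameter. -/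
theorem IsTikhonovPoint.norm_sub_le_of_param (hL : IsConvexConcave L) {z₀ y y' : PairSpace m n}
    {lam mu : ℝ} (hy : IsTikhonovPoint L z₀ lam y)
    (hy' : IsTikhonovPoint L z₀ mu y') :
    lam * ‖y' - y‖ ≤ |lam - mu| * ‖y' - z₀‖ := by
  have h := saddleOperator_monotone (hy'.mem_saddleOperator hL) (hy.mem_saddleOperator hL)
  have e : -(mu • (y' - z₀)) - -(lam • (y - z₀)) = (lam - mu) • (y' - z₀) - lam • (y' - y) := by
    module
  rw [e, inner_sub_left, inner_smul_left, inner_smul_left, real_inner_self_eq_norm_sq] at h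
  simp only [conj_trivial] at h
  have h2 : (lam - mu) * inner ℝ (y' - z₀) (y' - y) ≤ |lam - mu| * (‖y' - z₀‖ * ‖y' - y‖) := by
    refine (le_abs_self _).trans ?_
    rw [abs_mul]
    gcongr
    exact abs_real_inner_le_norm _ _
  rcases (norm_nonneg (y' - y)).eq_or_lt with h0 | h0
  · rw [← h0, mul_zero]
    positivity
  · refine le_of_mul_le_mul_right ?_ h0
    nlinarith

/-- Sion's theorem on closed balls about the anchor gives a constrained saddle point. Comparison
with `w` keeps it within `‖w - z₀‖` of the anchor, hence strictly inside the balls, and convexity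
makes it global. -/
theorem exists_isTikhonovPoint (hL : IsConvexConcave L) (hsaddle : ∃ z, IsSaddlePoint L z)
    (z₀ : PairSpace m n) {lam : ℝ} (hlam : 0 < lam) : ∃ y, IsTikhonovPoint L z₀ lam y := by
  obtain ⟨w, hw⟩ := hsaddle
  -- The extra `1` places the constrained saddle point in the open balls.
  set r := ‖w - z₀‖ + 1 with hr
  set f : EuclideanSpace ℝ (Fin m) → EuclideanSpace ℝ (Fin n) → ℝ := fun x u =>
    L x u + lam / 2 * (‖x - z₀.fst‖ ^ 2 - ‖u - z₀.snd‖ ^ 2) with hf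
  have hcx : ∀ u, ConvexOn ℝ Set.univ (fun x => f x u) := by
    intro u
    have := ((hL.1 u).add ((convexOn_sq_norm_sub z₀.fst).smul
      (by positivity : 0 ≤ lam / 2))).add_const (-(lam / 2 * ‖u - z₀.snd‖ ^ 2))
    refine this.congr fun x _ => ?_
    simp only [Pi.add_apply, smul_eq_mul, hf]
    ring
  have hcu : ∀ x, ConcaveOn ℝ Set.univ (fun u => f x u) := by
    intro x
    have := ((hL.2 x).sub ((convexOn_sq_norm_sub z₀.snd).smul
      (by positivity : 0 ≤ lam / 2))).add_const (lam / 2 * ‖x - z₀.fst‖ ^ 2)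
    refine this.congr fun u _ => ?_
    change L x u - lam / 2 * ‖u - z₀.snd‖ ^ 2 + lam / 2 * ‖x - z₀.fst‖ ^ 2 = f x u
    simp only [hf]
    ring
  have hr0 : 0 ≤ r := by positivity
  have hcontx : ∀ u, Continuous (fun x => f x u) := fun u => (hcx u).locallyLipschitz.continuous
  have hcontu : ∀ x, Continuous (fun u => f x u) := fun x => by
    have := ((hcu x).neg.locallyLipschitz.continuous).neg
    simpa using this
  obtain ⟨a, ha, b, hb, hab⟩ := Sion.exists_isSaddlePointOn
    (X := Metric.closedBall z₀.fst r) (Y := Metric.closedBall z₀.snd r) (f := f)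
    (Metric.nonempty_closedBall.2 hr0) (convex_closedBall _ _) (isCompact_closedBall _ _)
    (fun u _ => (hcontx u).lowerSemicontinuous.lowerSemicontinuousOn _)
    (fun u _ => ((hcx u).subset (Set.subset_univ _) (convex_closedBall _ _)).quasiconvexOn)
    (convex_closedBall _ _) (Metric.nonempty_closedBall.2 hr0) (isCompact_closedBall _ _)
    (fun x _ => (hcontu x).upperSemicontinuous.upperSemicontinuousOn _)
    (fun x _ => ((hcu x).subset (Set.subset_univ _) (convex_closedBall _ _)).quasiconcaveOn)
  have hwn : ‖w - z₀‖ ^ 2 = ‖w.fst - z₀.fst‖ ^ 2 + ‖w.snd - z₀.snd‖ ^ 2 :=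
    WithLp.prod_norm_sq_eq_of_L2 _
  have hw1 : ‖w.fst - z₀.fst‖ ≤ r := by
    refine le_trans (abs_le_of_sq_le_sq' ?_ (norm_nonneg (w - z₀))).2 (by linarith)
    rw [hwn]
    nlinarith [sq_nonneg ‖w.snd - z₀.snd‖]
  have hw2 : ‖w.snd - z₀.snd‖ ≤ r := by
    refine le_trans (abs_le_of_sq_le_sq' ?_ (norm_nonneg (w - z₀))).2 (by linarith)
    rw [hwn]
    nlinarith [sq_nonneg ‖w.fst - z₀.fst‖]
  have hbound : ‖a - z₀.fst‖ ^ 2 + ‖b - z₀.snd‖ ^ 2 ≤ ‖w - z₀‖ ^ 2 := by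
    have h1 := hab w.fst (by simpa [dist_eq_norm] using hw1) w.snd
      (by simpa [dist_eq_norm] using hw2)
    have h2 := hw a b
    have h3 := h2.1.trans h2.2
    rw [hwn]
    simp only [hf] at h1
    have : lam / 2 * (‖a - z₀.fst‖ ^ 2 + ‖b - z₀.snd‖ ^ 2)
        ≤ lam / 2 * (‖w.fst - z₀.fst‖ ^ 2 + ‖w.snd - z₀.snd‖ ^ 2) := by linarith
    exact le_of_mul_le_mul_left this (by positivity)
  have ha' : a ∈ Metric.ball z₀.fst r := by
    rw [Metric.mem_ball, dist_eq_norm]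
    refine lt_of_le_of_lt (abs_le_of_sq_le_sq' ?_ (norm_nonneg (w - z₀))).2 (by linarith)
    nlinarith [sq_nonneg ‖b - z₀.snd‖]
  have hb' : b ∈ Metric.ball z₀.snd r := by
    rw [Metric.mem_ball, dist_eq_norm]
    refine lt_of_le_of_lt (abs_le_of_sq_le_sq' ?_ (norm_nonneg (w - z₀))).2 (by linarith)
    nlinarith [sq_nonneg ‖a - z₀.fst‖]
  refine ⟨WithLp.toLp 2 (a, b), fun x u => ?_⟩
  have h1 := (hcx b).le_of_forall_mem_closedBall_le ha' (fun x hx => hab x hx b hb) x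
  have h2 := (hcu a).neg.le_of_forall_mem_closedBall_le hb'
    (fun u hu => neg_le_neg (hab a ha u hu)) u
  exact (neg_le_neg_iff.1 h2).trans h1

theorem IsConvexConcave.continuous_left (hL : IsConvexConcave L) (u) :
    Continuous fun x => L x u :=
  (hL.1 u).locallyLipschitz.continuous

theorem IsConvexConcave.continuous_right (hL : IsConvexConcave L) (x) :
    Continuous fun u => L x u := by
  simpa using ((hL.2 x).neg.locallyLipschitz.continuous).neg

theorem isProjectionOnto_of_sq_norm_le_inner {E : Type*} [NormedAddCommGroup E]
    [InnerProductSpace ℝ E] {S : Set E} {z₀ z : E} (hz : z ∈ S)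
    (h : ∀ w ∈ S, ‖z - z₀‖ ^ 2 ≤ inner ℝ (z - z₀) (w - z₀)) : IsProjectionOnto S z₀ z := by
  refine ⟨hz, fun w hw hne => ?_⟩
  have h1 := h w hw
  have h2 : ‖w - z‖ ^ 2 = ‖w - z₀‖ ^ 2 - 2 * inner ℝ (z - z₀) (w - z₀) + ‖z - z₀‖ ^ 2 := by
    rw [real_inner_comm, ← norm_sub_sq_real]
    congr 2
    abel
  have h3 : 0 < ‖w - z‖ := norm_pos_iff.2 (sub_ne_zero.2 hne)
  exact lt_of_pow_lt_pow_left₀ 2 (norm_nonneg _) (by nlinarith)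

theorem IsProjectionOnto.eq {E : Type*} [NormedAddCommGroup E] {S : Set E} {z₀ z w : E}
    (hz : IsProjectionOnto S z₀ z) (hw : IsProjectionOnto S z₀ w) : z = w := by
  by_contra hne
  exact lt_asymm (hz.2 w hw.1 (Ne.symm hne)) (hw.2 z hz.1 hne)

/-- Cluster points of a Tikhonov path with vanishing regularization are the projection of the
anchor onto the set of saddle points. -/
theorem isProjectionOnto_of_mapClusterPt (hL : IsConvexConcave L) {z₀ : PairSpace m n}
    {lam : ℕ → ℝ} (hpos : ∀ k, 0 < lam k) (hlim : Tendsto lam atTop (𝓝 0))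
    {y : ℕ → PairSpace m n} (hy : ∀ k, IsTikhonovPoint L z₀ (lam k) (y k)) {c : PairSpace m n}
    (hc : MapClusterPt c atTop y) : IsProjectionOnto {z | IsSaddlePoint L z} z₀ c := by
  obtain ⟨φ, hφ, hφc⟩ := hc.tendsto_subseq
  have hlim' := hlim.comp hφ.tendsto_atTop
  have hfst : Tendsto (fun k => (y (φ k)).fst) atTop (𝓝 c.fst) :=
    ((WithLp.prod_continuous_ofLp 2 _ _).fst.tendsto c).comp hφc
  have hsnd : Tendsto (fun k => (y (φ k)).snd) atTop (𝓝 c.snd) :=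
    ((WithLp.prod_continuous_ofLp 2 _ _).snd.tendsto c).comp hφc
  have hsad : IsSaddlePoint L c := by
    rw [← isTikhonovPoint_zero_iff (z₀ := z₀)]
    intro x u
    refine le_of_tendsto_of_tendsto' (b := atTop) ?_ ?_ (fun k => hy (φ k) x u)
    · exact (((hL.continuous_left u).tendsto _).comp hfst).add ((hlim'.div_const 2).mul
        (((hfst.sub_const _).norm.pow 2).sub_const _))
    · exact (((hL.continuous_right x).tendsto _).comp hsnd).add ((hlim'.div_const 2).mul
        (((hsnd.sub_const _).norm.pow 2).const_sub _))
  refine isProjectionOnto_of_sq_norm_le_inner hsad fun w hw => ?_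
  exact le_of_tendsto_of_tendsto' ((hφc.sub_const z₀).norm.pow 2)
    ((hφc.sub_const z₀).inner tendsto_const_nhds)
    (fun k => (hy (φ k)).sq_norm_sub_le_inner hL (hpos _) hw)

/-- The path stays in a compact ball and all its cluster points are the projection, which is unique.
Existence of the projection comes out of the same argument. -/
theorem exists_isProjectionOnto_tendsto (hL : IsConvexConcave L)
    (hsaddle : ∃ z, IsSaddlePoint L z) {z₀ : PairSpace m n} {lam : ℕ → ℝ}
    (hpos : ∀ k, 0 < lam k) (hlim : Tendsto lam atTop (𝓝 0))
    {y : ℕ → PairSpace m n} (hy : ∀ k, IsTikhonovPoint L z₀ (lam k) (y k)) :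
    ∃ zs, IsProjectionOnto {z | IsSaddlePoint L z} z₀ zs ∧ Tendsto y atTop (𝓝 zs) := by
  obtain ⟨w, hw⟩ := hsaddle
  have hK := isCompact_closedBall z₀ ‖w - z₀‖
  have hmem : ∀ k, y k ∈ Metric.closedBall z₀ ‖w - z₀‖ := fun k => by
    rw [Metric.mem_closedBall, dist_eq_norm]
    exact (hy k).norm_sub_le hL (hpos k) hw
  obtain ⟨c, -, hc⟩ := hK.exists_mapClusterPt (f := atTop) (u := y)
    (le_principal_iff.2 (mem_map.2 (Eventually.of_forall hmem)))
  have hproj := isProjectionOnto_of_mapClusterPt hL hpos hlim hy hc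
  exact ⟨c, hproj, hK.tendsto_nhds_of_unique_mapClusterPt (Eventually.of_forall hmem)
    fun x _ hx => (isProjectionOnto_of_mapClusterPt hL hpos hlim hy hx).eq hproj⟩

end Saddle

/-! ### Deterministic recursive inequalities -/

section Recursion

theorem tendsto_zero_of_le_one_sub_mul_add {a b η : ℕ → ℝ} (ha : ∀ k, 0 ≤ a k)
    (hb : ∀ᶠ k in atTop, 0 ≤ b k ∧ b k ≤ 1)
    (hsum : Tendsto (fun N => ∑ i ∈ Finset.range N, b i) atTop atTop)
    (hη : Tendsto η atTop (𝓝 0))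
    (h : ∀ᶠ k in atTop, a (k + 1) ≤ (1 - b k) * a k + b k * η k) :
    Tendsto a atTop (𝓝 0) := by
  refine tendsto_order.2 ⟨fun x hx => Eventually.of_forall fun k => hx.trans_le (ha k),
    fun x hx => ?_⟩
  have he : 0 < x / 2 := half_pos hx
  obtain ⟨K, hK⟩ := eventually_atTop.1 (hb.and (h.and (hη.eventually_lt_const he)))
  set S := fun N => ∑ i ∈ Finset.range N, b i with hS
  -- Since `1 - b ≤ exp (-b)`, the excess of `a` over the level `x / 2` decays at least like the
  -- exponential of minus the partial sums of `b`.
  have claim : ∀ j, K ≤ j → a j ≤ x / 2 + a K * Real.exp (S K - S j) := by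
    intro j hj
    induction j, hj using Nat.le_induction with
    | base => simp [he.le]
    | succ j hj ih =>
      obtain ⟨⟨hb0, hb1⟩, hrec, hlt⟩ := hK j hj
      have hSj : S K - S (j + 1) = (S K - S j) + -b j := by
        simp only [hS, Finset.sum_range_succ]
        ring
      have hexp : 1 - b j ≤ Real.exp (-b j) := by
        have := Real.add_one_le_exp (-b j)
        linarith
      rw [hSj, Real.exp_add]
      have hpos : 0 ≤ a K * Real.exp (S K - S j) := mul_nonneg (ha K) (Real.exp_pos _).le
      have h1 : (1 - b j) * a j ≤ (1 - b j) * (x / 2 + a K * Real.exp (S K - S j)) :=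
        mul_le_mul_of_nonneg_left ih (by linarith)
      have h2 : b j * η j ≤ b j * (x / 2) := mul_le_mul_of_nonneg_left hlt.le hb0
      have h3 := mul_le_mul_of_nonneg_left hexp hpos
      nlinarith
  have hlim : Tendsto (fun j => x / 2 + a K * Real.exp (S K - S j)) atTop
      (𝓝 (x / 2 + a K * 0)) := by
    refine tendsto_const_nhds.add (tendsto_const_nhds.mul (Real.tendsto_exp_atBot.comp ?_))
    exact tendsto_atBot_add_const_left _ _ (tendsto_neg_atTop_atBot.comp hsum)
  have hx2 : x / 2 + a K * 0 < x := by linarith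
  filter_upwards [hlim.eventually_lt_const hx2, eventually_ge_atTop K] with j hj hjK
  exact (claim j hjK).trans_lt hj

/-- Mean-square errors of an anchored stochastic method with step sizes `α`, anchoring weights
`β`, and drift `s` of the reference points. -/
theorem tendsto_zero_of_anchored_recursion {a α β s : ℕ → ℝ} {C : ℝ}
    (ha : ∀ k, 0 ≤ a k) (hβpos : ∀ k, 0 < β k) (hβ : Tendsto β atTop (𝓝 0))
    (hsum : Tendsto (fun N => ∑ i ∈ Finset.range N, β i) atTop atTop)
    (hα : Tendsto (fun k => α k ^ 2 / β k) atTop (𝓝 0))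
    (hs : Tendsto (fun k => s k / β k) atTop (𝓝 0))
    (h : ∀ k, a (k + 1) ≤ (1 + β k) * ((1 - 2 * β k + C * α k ^ 2) * a k + C * α k ^ 2)
      + (1 + 1 / β k) * s k ^ 2) :
    Tendsto a atTop (𝓝 0) := by
  have hCα : Tendsto (fun k => C * (α k ^ 2 / β k)) atTop (𝓝 0) := by
    simpa using hα.const_mul C
  refine tendsto_zero_of_le_one_sub_mul_add (b := fun k => β k / 2)
    (η := fun k => 2 * ((1 + β k) * (C * (α k ^ 2 / β k))
      + (1 + β k) * (s k / β k) ^ 2)) ha ?_ ?_ ?_ ?_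
  · filter_upwards [hβ.eventually_le_const one_pos] with k hk
    exact ⟨(half_pos (hβpos k)).le, by linarith⟩
  · simp only [← Finset.sum_div]
    exact hsum.atTop_div_const two_pos
  · have h1 : Tendsto (fun k => 1 + β k) atTop (𝓝 (1 + 0)) := tendsto_const_nhds.add hβ
    have := ((h1.mul hCα).add (h1.mul (hs.pow 2))).const_mul 2
    simpa using this
  · filter_upwards [hβ.eventually_le_const one_pos,
      hCα.eventually_le_const (by norm_num : (0 : ℝ) < 1 / 4)] with k hk1 hk2
    have hb := hβpos k
    have e1 : C * (α k ^ 2 / β k) * β k = C * α k ^ 2 := by field_simp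
    have e2 : (s k / β k) * β k = s k := by field_simp
    have e3 : (1 + 1 / β k) * s k ^ 2 = β k * (1 + β k) * (s k / β k) ^ 2 := by
      field_simp
      ring
    have h1 : C * α k ^ 2 ≤ β k / 4 := by
      rw [← e1]
      nlinarith
    -- Of the gain `2 * β k`, the factor `1 + β k` costs `β k` and the noise at most `β k / 4` to
    -- first order; `β k / 2` is safely left.
    have h2 : (1 + β k) * (1 - 2 * β k + C * α k ^ 2) ≤ 1 - β k / 2 := by
      nlinarith
    have h3 := mul_le_mul_of_nonneg_right h2 (ha k)
    have h4 := h k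
    rw [e3] at h4
    have e4 : β k / 2 * (2 * ((1 + β k) * (C * (α k ^ 2 / β k)) + (1 + β k) * (s k / β k) ^ 2))
        = (1 + β k) * (C * α k ^ 2) + β k * (1 + β k) * (s k / β k) ^ 2 := by
      rw [← e1]
      ring
    rw [e4]
    linarith

end Recursion

/-! ### Asymptotics of the step sizes -/

section StepSizes

theorem tendsto_natCast_add_one_rpow_neg {r : ℝ} (hr : 0 < r) :
    Tendsto (fun k : ℕ => ((k : ℝ) + 1) ^ (-r)) atTop (𝓝 0) :=
  (tendsto_rpow_neg_atTop hr).comp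
    (tendsto_atTop_add_const_right _ _ tendsto_natCast_atTop_atTop)

theorem tendsto_sum_const_div_rpow {c r : ℝ} (hc : 0 < c) (hr : r ≤ 1) :
    Tendsto (fun N => ∑ i ∈ Finset.range N, c / ((i : ℝ) + 1) ^ r) atTop atTop := by
  rw [← not_summable_iff_tendsto_nat_atTop_of_nonneg (fun i => by positivity)]
  intro h
  have h1 : Summable (fun i : ℕ => 1 / ((i : ℝ) + 1) ^ r) := by
    refine (h.mul_left c⁻¹).congr fun i => ?_
    field_simp
  have h2 : Summable (fun i : ℕ => 1 / (i : ℝ) ^ r) := by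
    rw [← summable_nat_add_iff 1]
    simpa using h1
  rw [Real.summable_one_div_nat_rpow] at h2
  linarith

/-- Relative decrease of the regularization weights `γ / (k + 1) ^ q`, `q ≤ 1`. -/
theorem abs_rpow_neg_sub_le {γ q : ℝ} (hγ : 0 < γ) (hq0 : 0 ≤ q) (hq : q ≤ 1) (k : ℕ) :
    |γ * ((k : ℝ) + 1) ^ (-q) - γ * ((k : ℝ) + 1 + 1) ^ (-q)|
      ≤ γ * ((k : ℝ) + 1) ^ (-q) * (1 / ((k : ℝ) + 1)) := by
  have hk : (0 : ℝ) < (k : ℝ) + 1 := by positivity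
  set t := (k : ℝ) + 1 with ht
  have hle : (t + 1) ^ (-q) ≤ t ^ (-q) :=
    Real.rpow_le_rpow_of_nonpos hk (by linarith) (by linarith)
  have hx0 : 0 < t / (t + 1) := by positivity
  have hx1 : t / (t + 1) ≤ 1 := by rw [div_le_one (by positivity)]; linarith
  -- For a base in `(0, 1]`, an exponent `q ≤ 1` only increases the value.
  have hratio : t / (t + 1) ≤ (t / (t + 1)) ^ q := by
    simpa using Real.rpow_le_rpow_of_exponent_ge hx0 hx1 hq
  have e : (t + 1) ^ (-q) = t ^ (-q) * (t / (t + 1)) ^ q := by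
    rw [Real.div_rpow hk.le (by positivity), Real.rpow_neg hk.le, Real.rpow_neg (by positivity)]
    have := (Real.rpow_pos_of_pos hk q).ne'
    field_simp
  rw [abs_of_nonneg (by nlinarith)]
  have h1 : 1 - 1 / t ≤ t / (t + 1) := by
    rw [← sub_nonneg]
    have : t / (t + 1) - (1 - 1 / t) = 1 / (t * (t + 1)) := by
      field_simp
      ring
    rw [this]
    positivity
  have hp : 0 < γ * t ^ (-q) := by positivity
  rw [e]
  nlinarith [mul_le_mul_of_nonneg_left (h1.trans hratio) hp.le]

end StepSizes

/-! ### Oracle moments and expected one-step progress -/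

section Oracle

variable {m n : ℕ} {Ξ : Type*} [MeasurableSpace Ξ] {ν : Measure Ξ} [IsProbabilityMeasure ν]
  {g : PairSpace m n → Ξ → PairSpace m n} {R₁ R₂ : ℝ}

theorem sq_norm_add_le_two_mul {E : Type*} [SeminormedAddCommGroup E] (a b : E) :
    ‖a + b‖ ^ 2 ≤ 2 * ‖a‖ ^ 2 + 2 * ‖b‖ ^ 2 := by
  nlinarith [norm_add_le a b, norm_nonneg (a + b), sq_nonneg (‖a‖ - ‖b‖), norm_nonneg a,
    norm_nonneg b]

/-- The hypothesis controls only differences of independent copies. By Fubini the second noise can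
be frozen at some `c` with integrable section, and `g z c` is then a constant. -/
theorem SecondMomentBound.integrable_sq_norm (h : SecondMomentBound ν g R₁ R₂)
    (hm : Measurable (Function.uncurry g)) (z : PairSpace m n) :
    Integrable (fun ξ => ‖g z ξ‖ ^ 2) ν := by
  obtain ⟨c, hc⟩ := (h z z).1.prod_left_ae.exists
  simp only at hc
  have hb : Integrable (fun ξ => 2 * ‖g z ξ - g z c‖ ^ 2 + 2 * ‖g z c‖ ^ 2) ν :=
    (hc.const_mul 2).add (integrable_const _)
  have hgz : Measurable (g z) := hm.comp measurable_prodMk_left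
  refine hb.mono' (hgz.norm.pow_const 2).aestronglyMeasurable (ae_of_all _ fun ξ => ?_)
  rw [Real.norm_eq_abs, abs_of_nonneg (by positivity)]
  simpa using sq_norm_add_le_two_mul (g z ξ - g z c) (g z c)

theorem SecondMomentBound.exists_growth_bound (h : SecondMomentBound ν g R₁ R₂)
    (hm : Measurable (Function.uncurry g)) :
    ∃ A, 0 ≤ A ∧ ∀ z, ∫ ξ, ‖g z ξ‖ ^ 2 ∂ν ≤ A * (1 + ‖z‖ ^ 2) := by
  set M := ∫ ξ, ‖g 0 ξ‖ ^ 2 ∂ν with hM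
  have hM0 : 0 ≤ M := integral_nonneg fun ξ => by positivity
  refine ⟨2 * R₁ ^ 2 + 2 * R₂ ^ 2 + 2 * M, by positivity, fun z => ?_⟩
  have h0 := h.integrable_sq_norm hm 0
  have hz := h.integrable_sq_norm hm z
  have e1 : ∫ ξ, ‖g z ξ‖ ^ 2 ∂ν = ∫ ξ : Ξ × Ξ, ‖g z ξ.1‖ ^ 2 ∂(ν.prod ν) := by
    rw [integral_fun_fst (fun ξ => ‖g z ξ‖ ^ 2)]
    simp
  have e2 : M = ∫ ξ : Ξ × Ξ, ‖g 0 ξ.2‖ ^ 2 ∂(ν.prod ν) := by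
    rw [integral_fun_snd (fun ξ => ‖g 0 ξ‖ ^ 2)]
    simp [hM]
  have hle : ∫ ξ : Ξ × Ξ, ‖g z ξ.1‖ ^ 2 ∂(ν.prod ν)
      ≤ ∫ ξ : Ξ × Ξ, (2 * ‖g z ξ.1 - g 0 ξ.2‖ ^ 2 + 2 * ‖g 0 ξ.2‖ ^ 2) ∂(ν.prod ν) := by
    refine integral_mono (hz.comp_fst ν)
      (((h z 0).1.const_mul 2).add ((h0.comp_snd ν).const_mul 2)) fun ξ => ?_
    simpa using sq_norm_add_le_two_mul (g z ξ.1 - g 0 ξ.2) (g 0 ξ.2)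
  rw [integral_add ((h z 0).1.const_mul 2) ((h0.comp_snd ν).const_mul 2), integral_const_mul,
    integral_const_mul, ← e2] at hle
  have h3 := (h z 0).2
  rw [sub_zero] at h3
  rw [e1]
  nlinarith [mul_nonneg hM0 (sq_nonneg ‖z‖), mul_nonneg (sq_nonneg R₂) (sq_nonneg ‖z‖),
    sq_nonneg R₁]

variable {L : EuclideanSpace ℝ (Fin m) → EuclideanSpace ℝ (Fin n) → ℝ}

theorem integrable_sq_norm_anchored_step (hg : IsStochasticSubgradientOracle L ν g)
    (hg₂ : SecondMomentBound ν g R₁ R₂) (α β : ℝ) (z z₀ y : PairSpace m n) :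
    Integrable (fun ξ => ‖z - α • g z ξ + β • (z₀ - z) - y‖ ^ 2) ν := by
  have hgz : Measurable (g z) := hg.measurable.comp measurable_prodMk_left
  have hL2 : MemLp (g z) 2 ν := (memLp_two_iff_integrable_sq_norm hgz.aestronglyMeasurable).2
    (hg₂.integrable_sq_norm hg.measurable z)
  have : MemLp (fun ξ => z - α • g z ξ + β • (z₀ - z) - y) 2 ν :=
    (((memLp_const z).sub (hL2.const_smul α)).add (memLp_const _)).sub (memLp_const y)
  exact (memLp_two_iff_integrable_sq_norm this.1).1 this

/-- Expected progress of one anchored step from `z` towards a regularized saddle point `y`. -/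
theorem integral_sq_norm_anchored_step_le (hL : IsConvexConcave L)
    (hg : IsStochasticSubgradientOracle L ν g) (hg₂ : SecondMomentBound ν g R₁ R₂)
    {lam α : ℝ} (hα : 0 ≤ α) {z₀ y : PairSpace m n}
    (hy : IsTikhonovPoint L z₀ lam y) (z : PairSpace m n) :
    ∫ ξ, ‖z - α • g z ξ + (α * lam) • (z₀ - z) - y‖ ^ 2 ∂ν
      ≤ (1 - 2 * (α * lam)) * ‖z - y‖ ^ 2
        + 2 * α ^ 2 * (∫ ξ, ‖g z ξ‖ ^ 2 ∂ν + lam ^ 2 * ‖z - z₀‖ ^ 2) := by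
  set β := α * lam with hβ
  have hint := hg₂.integrable_sq_norm hg.measurable z
  have hinner : Integrable (fun ξ => inner ℝ (z - y) (g z ξ)) ν :=
    (hg.integrable z).const_inner (z - y)
  have hle : ∫ ξ, ‖z - α • g z ξ + β • (z₀ - z) - y‖ ^ 2 ∂ν
      ≤ ∫ ξ, ((‖z - y‖ ^ 2 + 2 * β * inner ℝ (z - y) (z₀ - z) + 2 * β ^ 2 * ‖z - z₀‖ ^ 2)
        + (-(2 * α) * inner ℝ (z - y) (g z ξ) + 2 * α ^ 2 * ‖g z ξ‖ ^ 2)) ∂ν := by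
    refine integral_mono (integrable_sq_norm_anchored_step hg hg₂ α β z z₀ y)
      ((integrable_const _).add ((hinner.const_mul _).add (hint.const_mul _))) fun ξ => ?_
    have e : z - α • g z ξ + β • (z₀ - z) - y
        = (z - y) + (-(α • g z ξ) + β • (z₀ - z)) := by abel
    have h1 := sq_norm_add_le_two_mul (-(α • g z ξ)) (β • (z₀ - z))
    rw [norm_neg, norm_smul, norm_smul, mul_pow, mul_pow, Real.norm_eq_abs, Real.norm_eq_abs,
      sq_abs, sq_abs, norm_sub_rev z₀ z] at h1
    have h2 : inner ℝ (z - y) (-(α • g z ξ) + β • (z₀ - z))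
        = -α * inner ℝ (z - y) (g z ξ) + β * inner ℝ (z - y) (z₀ - z) := by
      rw [inner_add_right, inner_neg_right, inner_smul_right, inner_smul_right]
      ring
    simp only
    rw [e, norm_add_sq_real, h2]
    linarith
  have hadd : Integrable (fun ξ => -(2 * α) * inner ℝ (z - y) (g z ξ)
      + 2 * α ^ 2 * ‖g z ξ‖ ^ 2) ν := (hinner.const_mul _).add (hint.const_mul _)
  rw [integral_add (integrable_const _) hadd, integral_add (hinner.const_mul _) (hint.const_mul _), integral_const_mul, integral_const_mul,
    integral_inner (hg.integrable z)] at hle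
  simp only [integral_const, probReal_univ, one_smul] at hle
  -- The regularized operator vanishes at `y`: its anchor part supplies the term `-2 * β * ‖z - y‖ ^
  -- 2`, and `G` contributes with a favourable sign.
  have hmono := saddleOperator_monotone (hg.expectation_mem z) (hy.mem_saddleOperator hL)
  rw [sub_neg_eq_add, inner_add_left, inner_smul_left, real_inner_comm,
    real_inner_comm (z - y) (y - z₀)] at hmono
  simp only [conj_trivial] at hmono
  have e3 : inner ℝ (z - y) (z₀ - z) + inner ℝ (z - y) (y - z₀) = -‖z - y‖ ^ 2 := by
    rw [← inner_add_right, show z₀ - z + (y - z₀) = -(z - y) by abel, inner_neg_right,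
      real_inner_self_eq_norm_sq]
  have h4 := mul_nonneg hα hmono
  have h5 : α * (inner ℝ (z - y) (∫ ξ, g z ξ ∂ν) + lam * inner ℝ (z - y) (y - z₀))
      = α * inner ℝ (z - y) (∫ ξ, g z ξ ∂ν) + β * inner ℝ (z - y) (y - z₀) := by
    rw [hβ]
    ring
  rw [h5] at h4
  have h6 : β * inner ℝ (z - y) (z₀ - z) + β * inner ℝ (z - y) (y - z₀) = -(β * ‖z - y‖ ^ 2) := by
    rw [← mul_add, e3]
    ring
  have h7 : β ^ 2 = α ^ 2 * lam ^ 2 := by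
    rw [hβ]
    ring
  rw [h7] at hle
  linarith

/-- The constant in the expected progress is uniform in bounded regularized saddle points. -/
theorem exists_integral_sq_norm_anchored_step_le (hL : IsConvexConcave L)
    (hg : IsStochasticSubgradientOracle L ν g) (hg₂ : SecondMomentBound ν g R₁ R₂)
    (z₀ : PairSpace m n) (ρ Λ : ℝ) :
    ∃ C, ∀ (lam α : ℝ) (y z : PairSpace m n), 0 ≤ lam → lam ≤ Λ → 0 ≤ α → ‖y - z₀‖ ≤ ρ →
      IsTikhonovPoint L z₀ lam y →
      ∫ ξ, ‖z - α • g z ξ + (α * lam) • (z₀ - z) - y‖ ^ 2 ∂ν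
        ≤ (1 - 2 * (α * lam) + C * α ^ 2) * ‖z - y‖ ^ 2 + C * α ^ 2 := by
  obtain ⟨A, hA, hgrow⟩ := hg₂.exists_growth_bound hg.measurable
  -- The first two summands are the coefficient of `‖z - y‖ ^ 2`, the others the constant term;
  -- their sum serves as both, with surplus `h10`.
  refine ⟨4 * A + 4 * Λ ^ 2 + 2 * A + 8 * A * (ρ ^ 2 + ‖z₀‖ ^ 2) + 4 * Λ ^ 2 * ρ ^ 2,
    fun lam α y z hlam hlamΛ hα hyρ hy => ?_⟩
  refine (integral_sq_norm_anchored_step_le hL hg hg₂ hα hy z).trans ?_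
  have h1 := hgrow z
  have h2 : ‖z‖ ^ 2 ≤ 2 * ‖z - y‖ ^ 2 + 2 * ‖y‖ ^ 2 := by
    simpa using sq_norm_add_le_two_mul (z - y) y
  have h3 : ‖y‖ ^ 2 ≤ 2 * ‖y - z₀‖ ^ 2 + 2 * ‖z₀‖ ^ 2 := by
    simpa using sq_norm_add_le_two_mul (y - z₀) z₀
  have h4 : ‖z - z₀‖ ^ 2 ≤ 2 * ‖z - y‖ ^ 2 + 2 * ‖y - z₀‖ ^ 2 := by
    simpa using sq_norm_add_le_two_mul (z - y) (y - z₀)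
  have h5 : ‖y - z₀‖ ^ 2 ≤ ρ ^ 2 := by gcongr
  have h6 : lam ^ 2 ≤ Λ ^ 2 := by gcongr
  have h7 : ∫ ξ, ‖g z ξ‖ ^ 2 ∂ν
      ≤ A * (1 + (2 * ‖z - y‖ ^ 2 + 2 * (2 * ρ ^ 2 + 2 * ‖z₀‖ ^ 2))) :=
    h1.trans (mul_le_mul_of_nonneg_left (by linarith) hA)
  have h8 : lam ^ 2 * ‖z - z₀‖ ^ 2 ≤ Λ ^ 2 * (2 * ‖z - y‖ ^ 2 + 2 * ρ ^ 2) := by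
    gcongr
    linarith
  have h9 := mul_le_mul_of_nonneg_left (add_le_add h7 h8) (by positivity : 0 ≤ 2 * α ^ 2)
  have h10 : 0 ≤ α ^ 2 * ((2 * A + 8 * A * (ρ ^ 2 + ‖z₀‖ ^ 2) + 4 * Λ ^ 2 * ρ ^ 2)
      * ‖z - y‖ ^ 2 + (4 * A + 4 * Λ ^ 2)) := by positivity
  linarith

end Oracle

/-! ### Integrating out independent noise -/

section Independence

variable {Ω Ξ E : Type*} [MeasurableSpace Ω] [MeasurableSpace Ξ] [MeasurableSpace E]

/-- Integrate out the fresh noise `W` in `Φ (X, W)` when `X` and `W` are independent. -/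
theorem ProbabilityTheory.IndepFun.integrable_and_integral_le {P : Measure Ω}
    [IsProbabilityMeasure P] {ν : Measure Ξ} {X : Ω → E} {W : Ω → Ξ} (h : X ⟂ᵢ[P] W)
    (hX : Measurable X) (hW : Measurable W) (hν : P.map W = ν) {Φ : E × Ξ → ℝ}
    (hΦ : Measurable Φ) (hΦ0 : ∀ q, 0 ≤ Φ q) (hΦint : ∀ x, Integrable (fun ξ => Φ (x, ξ)) ν)
    {B : E → ℝ} (hB : Measurable B) (hΦB : ∀ x, ∫ ξ, Φ (x, ξ) ∂ν ≤ B x)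
    (hBint : Integrable (fun s => B (X s)) P) :
    Integrable (fun s => Φ (X s, W s)) P ∧ ∫ s, Φ (X s, W s) ∂P ≤ ∫ s, B (X s) ∂P := by
  have hmap := h.map_prod_eq_prod_map_map hX.aemeasurable hW.aemeasurable
  rw [hν] at hmap
  have : IsProbabilityMeasure (P.map X) := Measure.isProbabilityMeasure_map hX.aemeasurable
  have : IsProbabilityMeasure ν := hν ▸ Measure.isProbabilityMeasure_map hW.aemeasurable
  have hBX : Integrable B (P.map X) :=
    (integrable_map_measure hB.aestronglyMeasurable hX.aemeasurable).2 hBint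
  have hsm : StronglyMeasurable fun x => ∫ ξ, Φ (x, ξ) ∂ν :=
    StronglyMeasurable.integral_prod_right (f := fun x ξ => Φ (x, ξ)) hΦ.stronglyMeasurable
  have hsec : Integrable (fun x => ∫ ξ, Φ (x, ξ) ∂ν) (P.map X) :=
    hBX.mono' hsm.aestronglyMeasurable (ae_of_all _ fun x => by
      rw [Real.norm_eq_abs, abs_of_nonneg (integral_nonneg fun _ => hΦ0 _)]
      exact hΦB x)
  have hprod : Integrable Φ ((P.map X).prod ν) := by
    refine (integrable_prod_iff hΦ.aestronglyMeasurable).2 ⟨ae_of_all _ hΦint, ?_⟩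
    simpa only [Real.norm_eq_abs, abs_of_nonneg (hΦ0 _)] using hsec
  have hpair : Measurable fun s => (X s, W s) := hX.prodMk hW
  refine ⟨?_, ?_⟩
  · rw [← hmap] at hprod
    exact hprod.comp_measurable hpair
  · rw [← integral_map (f := Φ) hpair.aemeasurable hΦ.aestronglyMeasurable, hmap,
      integral_prod _ hprod, ← integral_map (f := B) hX.aemeasurable hB.aestronglyMeasurable]
    exact integral_mono hsec hBX hΦB

end Independence

/-! ### Adaptedness and square-integrability of the iterates -/

section Iterates

theorem measurable_anchored_step {m n : ℕ} {Ω : Type*} [MeasurableSpace Ω]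
    {Z G : Ω → PairSpace m n} (hZ : Measurable Z) (hG : Measurable G) (a b : ℝ)
    (z₀ : PairSpace m n) : Measurable fun s => Z s - a • G s + b • (z₀ - Z s) :=
  (hZ.sub (hG.const_smul a)).add ((measurable_const.sub hZ).const_smul b)

theorem memLp_anchored_step {m n : ℕ} {Ω : Type*} [MeasurableSpace Ω] {P : Measure Ω}
    [IsFiniteMeasure P] {Z G : Ω → PairSpace m n} (hZ : MemLp Z 2 P) (hG : MemLp G 2 P)
    (a b : ℝ) (z₀ : PairSpace m n) :
    MemLp (fun s => Z s - a • G s + b • (z₀ - Z s)) 2 P :=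
  (hZ.sub (hG.const_smul a)).add (((memLp_const z₀).sub hZ).const_smul b)

variable {m n : ℕ} {Ξ Ω : Type*} [MeasurableSpace Ξ] {g : PairSpace m n → Ξ → PairSpace m n}
  {ω : ℕ → Ω → Ξ}

/-- The strict bound `j < k` is what makes the iterate independent of the noise `ω k` used in the
next step. -/
theorem measurable_anchoredSSSGD_iSup_comap (hg : Measurable (Function.uncurry g))
    (p ε γ : ℝ) (z₀ : PairSpace m n) (k : ℕ) :
    Measurable[⨆ j ∈ {j | j < k}, MeasurableSpace.comap (ω j) inferInstance]
      (fun s => anchoredSSSGD g p ε γ z₀ (fun j => ω j s) k) := by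
  induction k with
  | zero => exact measurable_const
  | succ k ih =>
    have hle : (⨆ j ∈ {j | j < k}, MeasurableSpace.comap (ω j) inferInstance)
        ≤ ⨆ j ∈ {j | j < k + 1}, MeasurableSpace.comap (ω j) inferInstance :=
      biSup_mono fun j (hj : j < k) => Nat.lt_succ_of_lt hj
    have hz := ih.mono hle le_rfl
    have hωk : Measurable[⨆ j ∈ {j | j < k + 1}, MeasurableSpace.comap (ω j) inferInstance]
        (ω k) :=
      (comap_measurable (ω k)).mono
        (le_biSup (fun j => MeasurableSpace.comap (ω j) inferInstance) (Nat.lt_succ_self k)) le_rfl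
    let _ : MeasurableSpace Ω := ⨆ j ∈ {j | j < k + 1}, MeasurableSpace.comap (ω j) inferInstance
    have hgk : Measurable fun s => g (anchoredSSSGD g p ε γ z₀ (fun j => ω j s) k) (ω k s) :=
      hg.comp (hz.prodMk hωk)
    exact measurable_anchored_step hz hgk _ _ z₀

variable [MeasurableSpace Ω]

theorem measurable_anchoredSSSGD (hg : Measurable (Function.uncurry g))
    (hω : ∀ k, Measurable (ω k)) (p ε γ : ℝ) (z₀ : PairSpace m n) (k : ℕ) :
    Measurable (fun s => anchoredSSSGD g p ε γ z₀ (fun j => ω j s) k) :=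
  (measurable_anchoredSSSGD_iSup_comap hg p ε γ z₀ k).mono
    (iSup₂_le fun j _ => (hω j).comap_le) le_rfl

theorem indepFun_anchoredSSSGD {P : Measure Ω} (hg : Measurable (Function.uncurry g))
    (hω : ∀ k, Measurable (ω k)) (hind : iIndepFun ω P) (p ε γ : ℝ) (z₀ : PairSpace m n)
    (k : ℕ) : (fun s => anchoredSSSGD g p ε γ z₀ (fun j => ω j s) k) ⟂ᵢ[P] ω k := by
  rw [IndepFun_iff_Indep]
  have h := indep_iSup_of_disjoint (fun j => (hω j).comap_le) hind.iIndep
    (S := {j | j < k}) (T := {k}) (by simp)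
  refine indep_of_indep_of_le_left (indep_of_indep_of_le_right h ?_)
    (measurable_anchoredSSSGD_iSup_comap hg p ε γ z₀ k).comap_le
  simp

variable {L : EuclideanSpace ℝ (Fin m) → EuclideanSpace ℝ (Fin n) → ℝ} {ν : Measure Ξ}
  [IsProbabilityMeasure ν] {P : Measure Ω} [IsProbabilityMeasure P] {R₁ R₂ : ℝ}

theorem memLp_anchoredSSSGD (hg : IsStochasticSubgradientOracle L ν g)
    (hg₂ : SecondMomentBound ν g R₁ R₂) (hω : ∀ k, Measurable (ω k))
    (hωlaw : ∀ k, P.map (ω k) = ν) (hind : iIndepFun ω P) (p ε γ : ℝ) (z₀ : PairSpace m n)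
    (k : ℕ) : MemLp (fun s => anchoredSSSGD g p ε γ z₀ (fun j => ω j s) k) 2 P := by
  induction k with
  | zero => exact memLp_const z₀
  | succ k ih =>
    obtain ⟨A, -, hgrow⟩ := hg₂.exists_growth_bound hg.measurable
    have hzm := measurable_anchoredSSSGD hg.measurable hω p ε γ z₀ k
    have hgm : Measurable fun s => g (anchoredSSSGD g p ε γ z₀ (fun j => ω j s) k) (ω k s) :=
      hg.measurable.comp (hzm.prodMk (hω k))
    have hG : MemLp (fun s => g (anchoredSSSGD g p ε γ z₀ (fun j => ω j s) k) (ω k s)) 2 P := by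
      rw [memLp_two_iff_integrable_sq_norm hgm.aestronglyMeasurable]
      refine ((indepFun_anchoredSSSGD hg.measurable hω hind p ε γ z₀ k).integrable_and_integral_le
        hzm (hω k) (hωlaw k) (Φ := fun q => ‖g q.1 q.2‖ ^ 2)
        (hg.measurable.norm.pow_const 2) (fun q => by positivity)
        (hg₂.integrable_sq_norm hg.measurable) (B := fun z => A * (1 + ‖z‖ ^ 2)) (by fun_prop)
        hgrow ?_).1
      exact ((integrable_const 1).add ((memLp_two_iff_integrable_sq_norm ih.1).1 ih)).const_mul A
    exact memLp_anchored_step ih hG _ _ z₀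

end Iterates

/-! ### Mean-square tracking and convergence -/

section Convergence

theorem integrable_sq_norm_sub_const {Ω E : Type*} [MeasurableSpace Ω] [NormedAddCommGroup E]
    {P : Measure Ω} [IsFiniteMeasure P] {X : Ω → E} (hX : MemLp X 2 P) (y : E) :
    Integrable (fun s => ‖X s - y‖ ^ 2) P :=
  have h := hX.sub (memLp_const y)
  (memLp_two_iff_integrable_sq_norm h.1).1 h

/-- Young's inequality with weight `b`, for moving the reference point: `b = β k` along the path, `b
= 1` at the final passage to the projection. -/
theorem integral_sq_norm_sub_le_of_pos {Ω E : Type*} [MeasurableSpace Ω] [NormedAddCommGroup E]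
    {P : Measure Ω} [IsProbabilityMeasure P] {X : Ω → E} (hX : MemLp X 2 P) (y y' : E) {b : ℝ}
    (hb : 0 < b) : ∫ s, ‖X s - y'‖ ^ 2 ∂P
      ≤ (1 + b) * ∫ s, ‖X s - y‖ ^ 2 ∂P + (1 + 1 / b) * ‖y' - y‖ ^ 2 := by
  have hi := integrable_sq_norm_sub_const hX y
  have h : ∫ s, ‖X s - y'‖ ^ 2 ∂P
      ≤ ∫ s, ((1 + b) * ‖X s - y‖ ^ 2 + (1 + 1 / b) * ‖y' - y‖ ^ 2) ∂P := by
    refine integral_mono (integrable_sq_norm_sub_const hX y')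
      ((hi.const_mul _).add (integrable_const _)) fun s => ?_
    have h1 : ‖X s - y'‖ ≤ ‖X s - y‖ + ‖y' - y‖ := by
      rw [norm_sub_rev y' y]
      simpa using norm_add_le (X s - y) (y - y')
    have h2 : ‖X s - y'‖ ^ 2 ≤ (‖X s - y‖ + ‖y' - y‖) ^ 2 := by gcongr
    have h3 : (1 + b) * ‖X s - y‖ ^ 2 + (1 + 1 / b) * ‖y' - y‖ ^ 2
        = (‖X s - y‖ + ‖y' - y‖) ^ 2 + (b * ‖X s - y‖ - ‖y' - y‖) ^ 2 / b := by
      field_simp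
      ring
    simp only
    rw [h3]
    have : 0 ≤ (b * ‖X s - y‖ - ‖y' - y‖) ^ 2 / b := by positivity
    linarith
  rw [integral_add (hi.const_mul _) (integrable_const _), integral_const_mul] at h
  simpa using h

theorem tendsto_eLpNorm_two_of_tendsto_integral_sq_norm {Ω E : Type*} [MeasurableSpace Ω]
    [NormedAddCommGroup E] {P : Measure Ω} {X : ℕ → Ω → E} (hX : ∀ k, MemLp (X k) 2 P)
    (h : Tendsto (fun k => ∫ s, ‖X k s‖ ^ 2 ∂P) atTop (𝓝 0)) :
    Tendsto (fun k => eLpNorm (X k) 2 P) atTop (𝓝 0) := by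
  have e : ∀ k, eLpNorm (X k) 2 P = ENNReal.ofReal ((∫ s, ‖X k s‖ ^ 2 ∂P) ^ (2⁻¹ : ℝ)) := by
    intro k
    rw [(hX k).eLpNorm_eq_integral_rpow_norm two_ne_zero ENNReal.ofNat_ne_top]
    simp
  simp only [e]
  have h1 := h.rpow_const (p := (2⁻¹ : ℝ)) (Or.inr (by norm_num))
  rw [Real.zero_rpow (by norm_num)] at h1
  simpa using ENNReal.tendsto_ofReal h1

variable {m n : ℕ} {Ξ Ω : Type*} [MeasurableSpace Ξ] [MeasurableSpace Ω]
  {L : EuclideanSpace ℝ (Fin m) → EuclideanSpace ℝ (Fin n) → ℝ} {ν : Measure Ξ}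
  [IsProbabilityMeasure ν] {g : PairSpace m n → Ξ → PairSpace m n} {R₁ R₂ : ℝ}
  {P : Measure Ω} [IsProbabilityMeasure P] {ω : ℕ → Ω → Ξ}

theorem integral_sq_norm_anchoredSSSGD_succ_sub_le (hg : IsStochasticSubgradientOracle L ν g)
    (hg₂ : SecondMomentBound ν g R₁ R₂) (hω : ∀ k, Measurable (ω k))
    (hωlaw : ∀ k, P.map (ω k) = ν) (hind : iIndepFun ω P) (p ε γ : ℝ) (z₀ y : PairSpace m n)
    (k : ℕ) {c d : ℝ}
    (h : ∀ z, ∫ ξ, ‖z - ((1 - p) / ((k : ℝ) + 1) ^ p) • g z ξ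
      + ((1 - p) * γ / ((k : ℝ) + 1) ^ (1 - ε)) • (z₀ - z) - y‖ ^ 2 ∂ν
        ≤ c * ‖z - y‖ ^ 2 + d) :
    ∫ s, ‖anchoredSSSGD g p ε γ z₀ (fun j => ω j s) (k + 1) - y‖ ^ 2 ∂P
      ≤ c * ∫ s, ‖anchoredSSSGD g p ε γ z₀ (fun j => ω j s) k - y‖ ^ 2 ∂P + d := by
  have hi := integrable_sq_norm_sub_const
    (memLp_anchoredSSSGD hg hg₂ hω hωlaw hind p ε γ z₀ k) y
  have hgm : Measurable fun q : PairSpace m n × Ξ => g q.1 q.2 := hg.measurable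
  have hB := ((hi.const_mul c).add (integrable_const d))
  have hmain := ((indepFun_anchoredSSSGD hg.measurable hω hind p ε γ z₀
    k).integrable_and_integral_le (measurable_anchoredSSSGD hg.measurable hω p ε γ z₀ k) (hω k)
    (hωlaw k) (Φ := fun q => ‖q.1 - ((1 - p) / ((k : ℝ) + 1) ^ p) • g q.1 q.2
      + ((1 - p) * γ / ((k : ℝ) + 1) ^ (1 - ε)) • (z₀ - q.1) - y‖ ^ 2)
    (((measurable_anchored_step measurable_fst hgm _ _ z₀).sub_const y).norm.pow_const 2)
    (fun q => by positivity)
    (fun z => integrable_sq_norm_anchored_step hg hg₂ _ _ z z₀ y)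
    (B := fun z => c * ‖z - y‖ ^ 2 + d) (by fun_prop) h hB).2
  rw [integral_add (hi.const_mul c) (integrable_const d), integral_const_mul] at hmain
  simpa [anchoredSSSGD] using hmain

theorem tendsto_integral_sq_norm_anchoredSSSGD_sub (hL : IsConvexConcave L)
    {w : PairSpace m n} (hw : IsSaddlePoint L w) (hg : IsStochasticSubgradientOracle L ν g)
    (hg₂ : SecondMomentBound ν g R₁ R₂) (hω : ∀ k, Measurable (ω k))
    (hωlaw : ∀ k, P.map (ω k) = ν) (hind : iIndepFun ω P) {p ε γ : ℝ}
    (hp : p ∈ Set.Ioo (1 / 2 : ℝ) 1) (hε : ε ∈ Set.Ioo (0 : ℝ) (1 / 2))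
    (hpε : 0 < 1 - p - ε) (hγ : 0 < γ) (z₀ : PairSpace m n) {y : ℕ → PairSpace m n}
    (hy : ∀ k : ℕ, IsTikhonovPoint L z₀ (γ * ((k : ℝ) + 1) ^ (-(1 - p - ε))) (y k)) :
    Tendsto (fun k => ∫ s, ‖anchoredSSSGD g p ε γ z₀ (fun j => ω j s) k - y k‖ ^ 2 ∂P)
      atTop (𝓝 0) := by
  obtain ⟨hp1, hp2⟩ := hp
  obtain ⟨hε1, hε2⟩ := hε
  have h1p : 0 < 1 - p := by linarith
  set lam : ℕ → ℝ := fun k => γ * ((k : ℝ) + 1) ^ (-(1 - p - ε)) with hlam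
  have hlampos : ∀ k, 0 < lam k := fun k => by positivity
  have hlamle : ∀ k, lam k ≤ γ := fun k =>
    mul_le_of_le_one_right hγ.le
      (Real.rpow_le_one_of_one_le_of_nonpos (by simp) (by linarith))
  set ρ := ‖w - z₀‖
  have hyρ : ∀ k, ‖y k - z₀‖ ≤ ρ := fun k => (hy k).norm_sub_le hL (hlampos k) hw
  obtain ⟨C, hC⟩ := exists_integral_sq_norm_anchored_step_le hL hg hg₂ z₀ ρ γ
  set α : ℕ → ℝ := fun k => (1 - p) / ((k : ℝ) + 1) ^ p with hα
  set β : ℕ → ℝ := fun k => (1 - p) * γ / ((k : ℝ) + 1) ^ (1 - ε) with hβ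
  have hαβ : ∀ k, α k * lam k = β k := by
    intro k
    have hk : (0 : ℝ) < (k : ℝ) + 1 := by positivity
    simp only [hα, hβ, hlam]
    rw [show 1 - ε = p + (1 - p - ε) by ring, Real.rpow_add hk, Real.rpow_neg hk.le]
    field_simp
  have hβpos : ∀ k, 0 < β k := fun k => by positivity
  -- The relative decrease of `lam` is at most `1/(k+1)`, so `lam k` cancels.
  have hdrift : ∀ k, ‖y (k + 1) - y k‖ ≤ ρ / ((k : ℝ) + 1) := by
    intro k
    have h1 := (hy k).norm_sub_le_of_param hL (hy (k + 1))
    have h2 := abs_rpow_neg_sub_le hγ hpε.le (by linarith) k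
    push_cast at h1
    have h3 := h1.trans (mul_le_mul h2 (hyρ (k + 1)) (norm_nonneg _) (by positivity))
    refine le_of_mul_le_mul_left (h3.trans (le_of_eq ?_)) (hlampos k)
    ring
  refine tendsto_zero_of_anchored_recursion (α := α) (β := β)
    (s := fun k => ρ / ((k : ℝ) + 1)) (C := C) (fun k => integral_nonneg fun s => by positivity)
    hβpos ?_ (tendsto_sum_const_div_rpow (by positivity) (by linarith)) ?_ ?_ fun k => ?_
  · have h := (tendsto_natCast_add_one_rpow_neg
      (by linarith : 0 < 1 - ε)).const_mul ((1 - p) * γ)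
    rw [mul_zero] at h
    refine h.congr fun k => ?_
    rw [Real.rpow_neg (by positivity)]
    rfl
  -- `α ^ 2 / β` has order `(k+1)^(-(2p - 1 + ε))`; `p > 1/2` makes it vanish.
  · have h := (tendsto_natCast_add_one_rpow_neg
      (by linarith : 0 < p + p - (1 - ε))).const_mul ((1 - p) / γ)
    rw [mul_zero] at h
    refine h.congr fun k => ?_
    have hk : (0 : ℝ) < (k : ℝ) + 1 := by positivity
    simp only [hα, hβ]
    rw [neg_sub, Real.rpow_sub hk, Real.rpow_add hk]
    field_simp
  -- Drift over `β` has order `(k+1)^(-ε)`, hence the need for `ε > 0`.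
  · have h := (tendsto_natCast_add_one_rpow_neg hε1).const_mul (ρ / ((1 - p) * γ))
    rw [mul_zero] at h
    refine h.congr fun k => ?_
    have hk : (0 : ℝ) < (k : ℝ) + 1 := by positivity
    simp only [hβ]
    rw [Real.rpow_neg hk.le, Real.rpow_sub hk, Real.rpow_one]
    field_simp
  · have hhalf := integral_sq_norm_anchoredSSSGD_succ_sub_le hg hg₂ hω hωlaw hind p ε γ z₀ (y k) k
      (c := 1 - 2 * β k + C * α k ^ 2) (d := C * α k ^ 2) (fun z => by
        have := hC (lam k) (α k) (y k) z (hlampos k).le (hlamle k) (by positivity) (hyρ k) (hy k)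
        rwa [hαβ] at this)
    have hmove := integral_sq_norm_sub_le_of_pos
      (memLp_anchoredSSSGD hg hg₂ hω hωlaw hind p ε γ z₀ (k + 1)) (y k) (y (k + 1)) (hβpos k)
    have hb := hβpos k
    refine hmove.trans (add_le_add (mul_le_mul_of_nonneg_left hhalf (by positivity)) ?_)
    have := hdrift k
    gcongr

end Convergence

theorem theorem4 {m n : ℕ} {Ξ Ω : Type*} [MeasurableSpace Ξ] [MeasurableSpace Ω]
    (L : EuclideanSpace ℝ (Fin m) → EuclideanSpace ℝ (Fin n) → ℝ)
    (hL : IsConvexConcave L) (hsaddle : ∃ z, IsSaddlePoint L z)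
    -- the stochastic subgradient oracle and its second-moment bound
    (ν : Measure Ξ) [IsProbabilityMeasure ν]
    (g : PairSpace m n → Ξ → PairSpace m n)
    (hg : IsStochasticSubgradientOracle L ν g)
    (R₁ R₂ : ℝ) (hR₁ : 0 ≤ R₁) (hR₂ : 0 ≤ R₂) (hg₂ : SecondMomentBound ν g R₁ R₂)
    -- the IID noise, with law `ν`
    (P : Measure Ω) [IsProbabilityMeasure P]
    (ω : ℕ → Ω → Ξ) (hω : ∀ k, Measurable (ω k)) (hωlaw : ∀ k, P.map (ω k) = ν)
    (hωindep : iIndepFun ω P)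
    -- the parameters and the starting point
    (p ε γ : ℝ) (hp : p ∈ Set.Ioo (1 / 2 : ℝ) 1) (hε : ε ∈ Set.Ioo (0 : ℝ) (1 / 2))
    (hpε : 0 < 1 - p - ε) (hγ : 0 < γ) (z₀ : PairSpace m n) :
    ∃ zs : PairSpace m n, IsSaddlePoint L zs ∧
      IsProjectionOnto {z | IsSaddlePoint L z} z₀ zs ∧
      (∀ k, MemLp (fun s => anchoredSSSGD g p ε γ z₀ (fun j => ω j s) k) 2 P) ∧
      Tendsto (fun k => eLpNorm (fun s => anchoredSSSGD g p ε γ z₀ (fun j => ω j s) k - zs) 2 P)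
        atTop (𝓝 0) := by
  obtain ⟨w, hw⟩ := hsaddle
  have hpos : ∀ k : ℕ, 0 < γ * ((k : ℝ) + 1) ^ (-(1 - p - ε)) := fun k => by positivity
  choose y hy using fun k : ℕ => exists_isTikhonovPoint hL ⟨w, hw⟩ z₀ (hpos k)
  have hlim : Tendsto (fun k : ℕ => γ * ((k : ℝ) + 1) ^ (-(1 - p - ε))) atTop (𝓝 0) := by
    simpa using (tendsto_natCast_add_one_rpow_neg hpε).const_mul γ
  obtain ⟨zs, hproj, hyzs⟩ := exists_isProjectionOnto_tendsto hL ⟨w, hw⟩ hpos hlim hy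
  have hmem := memLp_anchoredSSSGD hg hg₂ hω hωlaw hωindep p ε γ z₀
  refine ⟨zs, hproj.1, hproj, hmem, ?_⟩
  refine tendsto_eLpNorm_two_of_tendsto_integral_sq_norm
    (fun k => (hmem k).sub (memLp_const zs)) ?_
  have ha := tendsto_integral_sq_norm_anchoredSSSGD_sub hL hw hg hg₂ hω hωlaw hωindep hp hε hpε
    hγ z₀ hy
  have hd : Tendsto (fun k => ‖zs - y k‖ ^ 2) atTop (𝓝 0) := by
    have := (hyzs.const_sub zs).norm.pow 2
    simpa using this
  have hsum := (ha.const_mul (1 + 1)).add (hd.const_mul (1 + 1 / 1))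
  rw [mul_zero, mul_zero, add_zero] at hsum
  exact squeeze_zero (fun k => integral_nonneg fun s => by positivity)
    (fun k => integral_sq_norm_sub_le_of_pos (hmem k) (y k) zs one_pos) hsum
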